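/- **Setting.** Let $G$ be a group acting by homeomorphisms on a metric space $\mathcal X$. Put $\mathsf{supp}(g)=\{x: g(x)\neq x\}$ and let $\mathsf{Fix}(G)$ be the set of points fixed by all of $G$. The action *hereditarily separates* $\mathcal X$ if $\mathcal X$ is infinite, $\mathsf{Fix}(G)$ is finite and, for every infinite open $Z\subseteq\mathcal X$, every finite $Y\subset Z$ and every $x\in Z\setminus(Y\cup\mathsf{Fix}(G))$, some $g\in G$ fixes $(\mathcal X\setminus Z)\cup Y$ pointwise and satisfies $g(x)\ne x$. **Words.** A word over $G$ on the variables $\bar y=(y_1,\dots,y_t)$ is an element $w(\bar y)$ of $\mathbb F_t*G$, written in its reduced form; it is non-constant if $w\notin G$. A word $w\notin\mathbb F_t$ is in *standard form* if its reduced form is $w=\mathsf u_nv_n\mathsf u_{n-1}v_{n-1}\cdots\mathsf u_1v_1$ with $n\ge1$, all $v_i\in G\setminus\{1\}$, all $\mathsf u_i\in\mathbb F_t$, and $\mathsf u_i\ne1$ for $i<n$. Every word $w\notin\mathbb F_t$ has reduced form $\cdots v\,\mathsf u$ with $v\in G\setminus\{1\}$ and $\mathsf u\in\mathbb F_t$ (possibly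 $\mathsf u=1$), and $\mathsf u w\mathsf u^{-1}$ is in standard form; we call it the standard form of $w$. A word in $\mathbb F_t$ is its own standard form, with $n=0$. For a word with standard form as above let $$O_w=\bigcap_{i=0}^{n-1}(v_i\cdots v_1)^{-1}(\mathsf{supp}(v_{i+1}))\ \text{ if } n\ge1,\qquad O_w=\mathcal X\setminus\mathsf{Fix}(G)\ \text{ if } n=0,$$ and for $A\subseteq\mathcal X$ let $\mathcal V_w(A)$ be the family of all sets $v_j^{\varepsilon_j}\cdots v_1^{\varepsilon_1}(A)$ with $1\le j\le n$ and $\varepsilon_1,\dots,\varepsilon_j\in\{0,1\}$, with $\mathcal V_w(A)=\{A\}$ if $n=0$. A word $w$ in standard form is *explicitly oscillating in* $V\subseteq\mathcal X$ if $w\ne1$ and $V\cap O_w\ne\emptyset$. **Transition.** For open $A\subseteq\mathcal X$ let $A^1=A\setminus\mathsf{Fix}(G)$ and $A^0=\mathsf{int}(\mathcal X\setminus(A\cup\mathsf{Fix}(G)))$. Given a word $w$, step $0$ yields the region $\mathcal X$ with the word $w_{\mathcal X}$, the standard form of $w$. From each region $V$ of step $k$ whose word $w_V=\mathsf u_nv_n\cdots\mathsf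 u_1v_1$ has $n\ge1$ constants, step $k+1$ yields all nonempty regions $$V_{\bar\varepsilon}=V\cap\bigcap_{i=1}^{n}(v_{i-1}\cdots v_1)^{-1}\big(\mathsf{supp}(v_i)^{\varepsilon_i}\big),\qquad \bar\varepsilon\in\{0,1\}^n,$$ each with the word $w_{V_{\bar\varepsilon}}$ which is the standard form of $\mathsf u_nv_n^{\varepsilon_n}\cdots\mathsf u_1v_1^{\varepsilon_1}$. The procedure stops at the first step at which some $w_V$ is explicitly oscillating in its region $V$. The word $w$ is *oscillating* if there is such a step; then $\mathcal P^{os}$ is the set of the regions $V$ of that step in which $w_V$ is explicitly oscillating, and $$\hat O_w=\bigcup_{V\in\mathcal P^{os}}\big((V\setminus\mathsf{Fix}(G))\cap O_{w_V}\big).$$ (If the standard form of $w$ is explicitly oscillating in $\mathcal X$, the procedure stops at step $0$ and $\hat O_w=O_w$.) **Theorem.** Let $G$ act on a perfect metric space $\mathcal X$ (one without isolated points) by homeomorphisms and hereditarily separate it. Let $w_1(\bar y),\dots,w_m(\bar y)\in\mathbb F_t*G$ be reduced non-constant words on $t$ variables, each of them oscillating. Then there is $\bar g=(g_1,\dots,g_t)\in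 G^t$ with $w_1(\bar g)\ne1,\dots,w_m(\bar g)\ne1$. Moreover, for any nonempty open sets $O_j\subseteq\hat O_{w_j}$, $1\le j\le m$, there is such a solution $\bar g$ with $$\mathsf{supp}(g_i)\subseteq\bigcup_{j=1}^m\bigcup\mathcal V_{w_j}(O_j)\qquad\text{for all } 1\le i\le t.$$ -/

import Mathlib

namespace MixedWords

/-! ### Words with constants, their evaluation, and form (1.1) -/

/-- Words over `G` on `t` variables: elements of the free product `F_t * G`. Every element of the
free product has exactly one reduced expression, so an element is the same as a reduced word. -/
abbrev GWord (t : ℕ) (G : Type*) [Group G] := Monoid.Coprod (FreeGroup (Fin t)) G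

/-- The list of blocks `[(uₙ, vₙ), …, (u₁, v₁)]`, in the order in which the word
`uₙ vₙ … u₁ v₁` is written. -/
abbrev Blocks (t : ℕ) (G : Type*) := List (FreeGroup (Fin t) × G)

section Words

variable {t : ℕ} {G : Type*} [Group G]

/-- A word in variables only, as a word over `G`. -/
def varWord (u : FreeGroup (Fin t)) : GWord t G := Monoid.Coprod.inl u

/-- A constant, as a word over `G`. -/
def constWord (v : G) : GWord t G := Monoid.Coprod.inr v

/-- The value `w(g₁, …, g_t)` in `G`. -/
def eval (g : Fin t → G) (w : GWord t G) : G :=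
  Monoid.Coprod.lift (FreeGroup.lift g) (MonoidHom.id G) w

/-- The power `v ^ ε` for `ε ∈ {0, 1}`. -/
def bpow (v : G) (ε : Bool) : G := if ε then v else 1

/-- The word `uₙ vₙ^εₙ … u₁ v₁^ε₁`. The exponent of `v_{i+1}` is `ε i`. -/
def truncWord (ε : ℕ → Bool) : Blocks t G → GWord t G
  | [] => 1
  | b :: T => varWord b.1 * constWord (bpow b.2 (ε T.length)) * truncWord ε T

/-- The word `uₙ vₙ … u₁ v₁`. -/
def blockWord (L : Blocks t G) : GWord t G := truncWord (fun _ => true) L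

/-- The product of constants `vₙ^εₙ … v₁^ε₁`. The exponent of `v_{i+1}` is `ε i`. -/
def truncConst (ε : ℕ → Bool) : Blocks t G → G
  | [] => 1
  | b :: T => bpow b.2 (ε T.length) * truncConst ε T

/-- The product of constants `vₙ … v₁`. -/
def blockConst (L : Blocks t G) : G := truncConst (fun _ => true) L

/-- The expression `uₙ vₙ … u₁ v₁` is reduced and has at least one constant: all constants are
nontrivial and all variable parts, except possibly the leftmost `uₙ`, are nontrivial. -/
structure IsReducedBlocks (L : Blocks t G) : Prop where
  ne_nil : L ≠ []
  const_ne_one : ∀ b ∈ L, b.2 ≠ 1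
  var_ne_one : ∀ b ∈ L.tail, b.1 ≠ 1

/-- `w'` is the standard form of `w`, and `L` is its list of blocks. A word without constants
is its own standard form and has no blocks. Any other word has the reduced expression
`… v u` with a constant `v ≠ 1` and `u` (possibly empty) in variables only; its standard form is
the conjugate `u w u⁻¹`, the reduced expression of which ends in the constant `v`.
A word which already ends in a constant is its own standard form. -/
def IsStandardForm (w w' : GWord t G) (L : Blocks t G) : Prop :=
  (L = [] ∧ w' = w ∧ ∃ u, w = varWord u) ∨
  (IsReducedBlocks L ∧ w' = blockWord L ∧ ∃ u, w' = varWord u * w * (varWord u)⁻¹)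

end Words

/-! ### Actions -/

/-- The support of an element: the points that it moves. -/
def supp {G : Type*} (X : Type*) [Group G] [MulAction G X] (g : G) : Set X :=
  (MulAction.fixedBy X g)ᶜ

/-- `G` hereditarily separates the space `X`. -/
structure HereditarilySeparates (G X : Type*) [Group G] [TopologicalSpace X] [MulAction G X] :
    Prop where
  infinite : Infinite X
  finite_fixedPoints : (MulAction.fixedPoints G X).Finite
  separates : ∀ Z : Set X, IsOpen Z → Z.Infinite → ∀ Y : Set X, Y.Finite → Y ⊆ Z →
    ∀ x ∈ Z \ (Y ∪ MulAction.fixedPoints G X), ∃ g ∈ fixingSubgroup G (Zᶜ ∪ Y), g • x ≠ x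

section Transition

variable {t : ℕ} {G X : Type*} [Group G] [TopologicalSpace X] [MulAction G X]

variable (G) in
/-- For open `A`: `A¹ = A \ Fix(G)` and `A⁰ = int (X \ (A ∪ Fix(G)))`. -/
def side (A : Set X) (ε : Bool) : Set X :=
  if ε then A \ MulAction.fixedPoints G X else interior (A ∪ MulAction.fixedPoints G X)ᶜ

variable (X) in
/-- The set `⋂ᵢ v₁⁻¹ … vᵢ⁻¹ (supp v_{i+1})`, over `0 ≤ i < n`. -/
def constRegion : Blocks t G → Set X
  | [] => Set.univ
  | b :: T => {x | blockConst T • x ∈ supp X b.2} ∩ constRegion T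

variable (X) in
/-- The set `X_ε = ⋂ᵢ v₁⁻¹ … vᵢ⁻¹ ((supp v_{i+1})^ε)`, over `0 ≤ i < n`. -/
def signRegion (ε : ℕ → Bool) : Blocks t G → Set X
  | [] => Set.univ
  | b :: T => {x | blockConst T • x ∈ side G (supp X b.2) (ε T.length)} ∩ signRegion ε T

variable (X) in
/-- The set `O_w` of a word with blocks `L`: it is `constRegion` if there are constants (their
supports contain no fixed point of `G`) and `X \ Fix(G)` for a word without constants. -/
def oscRegion (L : Blocks t G) : Set X := constRegion X L \ MulAction.fixedPoints G X

/-- The word `w` in standard form with blocks `L` is explicitly oscillating in `V`. -/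
def ExplicitlyOscillatingIn (V : Set X) (w : GWord t G) (L : Blocks t G) : Prop :=
  w ≠ 1 ∧ (V ∩ oscRegion X L).Nonempty

/-- `Stage w k V w_V L`: step `k` of the procedure Transition for `w` yields the nonempty region
`V` together with the word `w_V`, which is in standard form and has the blocks `L`. At step `0`
the region is the whole space and the word is the standard form of `w`. At each further step a
region `V` whose word has constants is cut into the nonempty regions `V ∩ X_ε`, and the word of
`V ∩ X_ε` is the standard form of `uₙ vₙ^εₙ … u₁ v₁^ε₁`. A word without constants is either
trivial or explicitly oscillating, so it is not treated any further. -/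
inductive Stage (w : GWord t G) : ℕ → Set X → GWord t G → Blocks t G → Prop
  | start {w' : GWord t G} {L : Blocks t G} (h : IsStandardForm w w' L) :
      Stage w 0 Set.univ w' L
  | step {k : ℕ} {V : Set X} {w' w'' : GWord t G} {L L' : Blocks t G} (ε : ℕ → Bool)
      (h : Stage w k V w' L) (hL : L ≠ []) (hne : (V ∩ signRegion X ε L).Nonempty)
      (h' : IsStandardForm (truncWord ε L) w'' L') :
      Stage w (k + 1) (V ∩ signRegion X ε L) w'' L'

variable (X) in
/-- Some word obtained at step `k` is explicitly oscillating in its region. -/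
def OscillatesAt (w : GWord t G) (k : ℕ) : Prop :=
  ∃ (V : Set X) (w' : GWord t G) (L : Blocks t G),
    Stage w k V w' L ∧ ExplicitlyOscillatingIn V w' L

variable (X) in
/-- Transition stops at step `k`, the first step with an explicitly oscillating word. The case
`k = 0` is that of an explicitly oscillating word `w`. -/
def StopsAt (w : GWord t G) (k : ℕ) : Prop :=
  OscillatesAt X w k ∧ ∀ i < k, ¬ OscillatesAt X w i

variable (X) in
/-- The word `w` is oscillating. -/
def Oscillating (w : GWord t G) : Prop := ∃ k, StopsAt X w k

variable (X) in
/-- The set `Ô_w`: the union of the sets `(V \ Fix(G)) ∩ O_{w_V}` over the regions `V` in which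
`w_V` is explicitly oscillating at the step where Transition stops. For an explicitly oscillating
word in standard form it is `O_w`. -/
def oscHat (w : GWord t G) : Set X :=
  {x | ∃ (k : ℕ) (V : Set X) (w' : GWord t G) (L : Blocks t G),
    StopsAt X w k ∧ Stage w k V w' L ∧ ExplicitlyOscillatingIn V w' L ∧ x ∈ V ∩ oscRegion X L}

/-- The family `𝒱_w(A)` of the sets `v_j^ε_j … v₁^ε₁ (A)`, `0 ≤ j ≤ n`, where `v₁, …, vₙ` are the
constants of the standard form of `w`. Here `j = 0` adds the set `A`, which is in the family
anyway if `n ≥ 1`, and makes the family `{A}` for a word without constants. -/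
def translates (w : GWord t G) (A : Set X) : Set (Set X) :=
  {B | ∃ (w' : GWord t G) (L T : Blocks t G) (ε : ℕ → Bool),
    IsStandardForm w w' L ∧ T <:+ L ∧ B = (fun x => truncConst ε T • x) '' A}

end Transition

end MixedWords

/-! Pick a point `x j` in each `O j`; it lies in a region of the stopping step, with a word `w' j`.
If a tuple moves all points very little, points near `x j` follow the orbit of `x j` under the
constants alone. A constant dropped by Transition is the identity near the point of this orbit where
it is applied, so near `x j` the word `w' j` acts as a conjugate of `w j`
(`Stage.exists_eval_smul_eq`). It remains to find a tuple of small displacement for which each `w'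
j` moves a point near `x j`.

Such a tuple is built by prescribing values at finitely many points while a point is followed along
`w' j`. A letter is applied where its value is still open; a small push
(`HereditarilySeparates.exists_push`) makes this value avoid the points used so far and their
preimages under the constants. A constant then takes the point off the used set, because `x j` lies
in the oscillation region, and reducedness prevents a letter from undoing the previous one. So the
end differs from the start. Later words alter only open values, hence all words can be treated in
turn (`forceable_forall`).

The pushes happen near the orbit of `x j` under the constants of `w' j`. Uniqueness of reduced forms
shows that this orbit is part of the one for the standard form of `w j`
(`Stage.exists_blockConst_smul`), which bounds the supports. -/

namespace MixedWords

/-! ### Evaluation of words -/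

section Evaluation

variable {t : ℕ} {G : Type*} [Group G]

theorem eval_mul (g : Fin t → G) (a b : GWord t G) : eval g (a * b) = eval g a * eval g b :=
  map_mul _ a b

theorem eval_one (g : Fin t → G) : eval g (1 : GWord t G) = 1 := map_one _

theorem eval_inv (g : Fin t → G) (a : GWord t G) : eval g a⁻¹ = (eval g a)⁻¹ := map_inv _ a

theorem eval_varWord (g : Fin t → G) (u : FreeGroup (Fin t)) :
    eval g (varWord u) = FreeGroup.lift g u := by
  simp [eval, varWord]

theorem eval_constWord (g : Fin t → G) (v : G) : eval g (constWord v) = v := by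
  simp [eval, constWord]

theorem varWord_mul (u u' : FreeGroup (Fin t)) :
    (varWord (u * u') : GWord t G) = varWord u * varWord u' := map_mul _ u u'

theorem varWord_one : (varWord 1 : GWord t G) = 1 := map_one _

theorem varWord_inv (u : FreeGroup (Fin t)) :
    (varWord u⁻¹ : GWord t G) = (varWord u)⁻¹ := map_inv _ u

theorem blockWord_cons (b : FreeGroup (Fin t) × G) (T : Blocks t G) :
    blockWord (b :: T) = varWord b.1 * constWord b.2 * blockWord T := rfl

theorem blockConst_cons (b : FreeGroup (Fin t) × G) (T : Blocks t G) :
    blockConst (b :: T) = b.2 * blockConst T := rfl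

theorem IsStandardForm.exists_conj {w w' : GWord t G} {L : Blocks t G}
    (h : IsStandardForm w w' L) : ∃ u, w' = varWord u * w * (varWord u)⁻¹ := by
  rcases h with ⟨-, rfl, -⟩ | ⟨-, -, u, hu⟩
  · exact ⟨1, by simp [varWord_one]⟩
  · exact ⟨u, hu⟩

theorem IsStandardForm.eq_blockWord {w w' : GWord t G} {L : Blocks t G}
    (h : IsStandardForm w w' L) (hL : L ≠ []) : w' = blockWord L := by
  rcases h with ⟨rfl, -⟩ | ⟨-, h, -⟩
  · exact absurd rfl hL
  · exact h

/-- The value of a letter `y_i` or `y_i⁻¹`. -/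
def letterVal (g : Fin t → G) (b : Fin t × Bool) : G := if b.2 then g b.1 else (g b.1)⁻¹

theorem eval_varWord_mk_cons (g : Fin t → G) (a : Fin t × Bool) (l : List (Fin t × Bool)) :
    eval g (varWord (FreeGroup.mk (a :: l))) = letterVal g a * eval g (varWord (.mk l)) := by
  obtain ⟨i, σ⟩ := a
  cases σ <;> simp [eval_varWord, letterVal]

end Evaluation

/-! ### Regions of Transition -/

section Stage

variable {t : ℕ} {G X : Type*} [Group G] [TopologicalSpace X] [MulAction G X]

theorem Stage.exists_isStandardForm {w w' : GWord t G} {k : ℕ} {V : Set X} {L : Blocks t G}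
    (h : Stage w k V w' L) : ∃ z, IsStandardForm z w' L := by
  cases h with
  | start h => exact ⟨_, h⟩
  | step ε h hL hne h' => exact ⟨_, h'⟩

theorem mem_signRegion_of_suffix {ε : ℕ → Bool} {L T : Blocks t G} {x : X}
    (hx : x ∈ signRegion X ε L) (hT : T <:+ L) : x ∈ signRegion X ε T := by
  induction L with
  | nil => rwa [List.suffix_nil.1 hT]
  | cons b L ih =>
    rcases List.suffix_cons_iff.1 hT with rfl | hT
    · exact hx
    · exact ih hx.2 hT

theorem smul_eq_of_mem_side_false {v : G} {y : X} (hy : y ∈ side G (supp X v) false) :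
    v • y = y := by
  by_contra h
  have hy' : y ∈ interior (supp X v ∪ MulAction.fixedPoints G X)ᶜ := by
    simpa only [side, Bool.false_eq_true, if_false] using hy
  exact interior_subset hy' (Or.inl h)

/-- A dropped constant fixes the point of the orbit of `x` to which it would be applied. -/
theorem truncConst_smul {ε : ℕ → Bool} {L : Blocks t G} {x : X}
    (hx : x ∈ signRegion X ε L) : truncConst ε L • x = blockConst L • x := by
  induction L with
  | nil => rfl
  | cons b T ih =>
    have h1 := hx.1
    rw [blockConst_cons, truncConst, mul_smul, mul_smul, ih hx.2]
    cases h : ε T.length with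
    | true => rfl
    | false =>
      rw [h] at h1
      rw [bpow, smul_eq_of_mem_side_false h1]
      simp

theorem Oscillating.oscHat_nonempty {w : GWord t G} (h : Oscillating X w) :
    (oscHat X w).Nonempty := by
  obtain ⟨k, hk⟩ := h
  obtain ⟨V, w', L, hs, he⟩ := hk.1
  obtain ⟨x, hx⟩ := he.2
  exact ⟨x, k, V, w', L, hk, hs, he, hx⟩

variable [T2Space X]

theorem isOpen_side (hF : (MulAction.fixedPoints G X).Finite) {A : Set X} (hA : IsOpen A)
    (ε : Bool) : IsOpen (side G A ε) := by
  cases ε with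
  | true => exact hA.sdiff hF.isClosed
  | false => exact isOpen_interior

variable [ContinuousConstSMul G X]

theorem isOpen_supp (v : G) : IsOpen (supp X v) :=
  isOpen_ne_fun (continuous_const_smul v) continuous_id

theorem isOpen_constRegion (L : Blocks t G) : IsOpen (constRegion X L) := by
  induction L with
  | nil => exact isOpen_univ
  | cons b T ih =>
    exact ((isOpen_supp b.2).preimage (continuous_const_smul (blockConst T))).inter ih

theorem isOpen_signRegion (hF : (MulAction.fixedPoints G X).Finite) (ε : ℕ → Bool)
    (L : Blocks t G) : IsOpen (signRegion X ε L) := by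
  induction L with
  | nil => exact isOpen_univ
  | cons b T ih =>
    exact ((isOpen_side hF (isOpen_supp b.2) _).preimage
      (continuous_const_smul (blockConst T))).inter ih

theorem Stage.isOpen (hF : (MulAction.fixedPoints G X).Finite) {w w' : GWord t G} {k : ℕ}
    {V : Set X} {L : Blocks t G} (h : Stage w k V w' L) : IsOpen V := by
  induction h with
  | start h => exact isOpen_univ
  | step ε h hL hne h' ih => exact ih.inter (isOpen_signRegion hF ε _)

theorem isOpen_oscHat (hF : (MulAction.fixedPoints G X).Finite) (w : GWord t G) :
    IsOpen (oscHat X w) := by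
  rw [isOpen_iff_mem_nhds]
  rintro x ⟨k, V, w', L, hk, hs, he, hx⟩
  refine Filter.mem_of_superset
    (((hs.isOpen hF).inter ((isOpen_constRegion L).sdiff hF.isClosed)).mem_nhds hx) ?_
  exact fun y hy => ⟨k, V, w', L, hk, hs, he, hy⟩

end Stage

/-! ### Words evaluated at tuples of small displacement -/

section Displacement

variable {t : ℕ} {G : Type*} (X : Type*) [Group G] [MetricSpace X] [MulAction G X]

/-- Every component of the tuple `g` moves every point by less than `δ`. -/
def MovesLess (δ : ℝ) (g : Fin t → G) : Prop := ∀ i, ∀ p : X, dist (g i • p) p < δ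

variable {X}

theorem MovesLess.mono {δ δ' : ℝ} {g : Fin t → G} (h : MovesLess X δ g) (hδ : δ ≤ δ') :
    MovesLess X δ' g := fun i p => (h i p).trans_le hδ

theorem exists_movesLess_eval_varWord (u : FreeGroup (Fin t)) {δ : ℝ} (hδ : 0 < δ) :
    ∃ η > 0, ∀ g : Fin t → G, MovesLess X η g →
      ∀ p : X, dist (eval g (varWord u) • p) p < δ := by
  induction u using FreeGroup.induction_on generalizing δ with
  | C1 => exact ⟨1, one_pos, fun g _ p => by simpa [eval_varWord] using hδ⟩
  | of i => exact ⟨δ, hδ, fun g hg p => by simpa [eval_varWord] using hg i p⟩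
  | inv_of i _ =>
    refine ⟨δ, hδ, fun g hg p => ?_⟩
    have := hg i ((g i)⁻¹ • p)
    rw [smul_inv_smul, dist_comm] at this
    simpa [eval_varWord] using this
  | mul a b iha ihb =>
    obtain ⟨η, hη, ha⟩ := iha (half_pos hδ)
    obtain ⟨η', hη', hb⟩ := ihb (half_pos hδ)
    refine ⟨min η η', lt_min hη hη', fun g hg p => ?_⟩
    rw [varWord_mul, eval_mul, mul_smul]
    have h1 := ha g (hg.mono (min_le_left _ _)) (eval g (varWord b) • p)
    have h2 := hb g (hg.mono (min_le_right _ _)) p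
    have := dist_triangle (eval g (varWord a) • eval g (varWord b) • p)
      (eval g (varWord b) • p) p
    linarith

variable [ContinuousConstSMul G X]

theorem exists_dist_smul_lt (v : G) (y : X) {δ : ℝ} (hδ : 0 < δ) :
    ∃ η > 0, ∀ q, dist q y < η → dist (v • q) (v • y) < δ :=
  Metric.continuousAt_iff.1 (continuous_const_smul v).continuousAt δ hδ

/-- The side for exponent `0` is an interior, so a dropped constant is the identity on a whole
neighbourhood of the orbit point, and small displacement keeps the trajectory of `p` inside it. -/
theorem exists_eval_truncWord_smul {ε : ℕ → Bool} {L : Blocks t G} {x : X}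
    (hx : x ∈ signRegion X ε L) {δ : ℝ} (hδ : 0 < δ) :
    ∃ η > 0, ∀ g : Fin t → G, MovesLess X η g → ∀ p : X, dist p x < η →
      eval g (truncWord ε L) • p = eval g (blockWord L) • p ∧
      dist (eval g (blockWord L) • p) (blockConst L • x) < δ := by
  induction L generalizing δ with
  | nil =>
    refine ⟨δ, hδ, fun g _ p hp => ⟨rfl, ?_⟩⟩
    simpa [blockWord, blockConst, truncWord, truncConst, eval_one] using hp
  | cons b T ih =>
    obtain ⟨δ₁, hδ₁, h₁⟩ := exists_dist_smul_lt b.2 (blockConst T • x) (half_pos hδ)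
    obtain ⟨δ₂, hδ₂, h₂⟩ : ∃ δ₂ > 0, ∀ q, dist q (blockConst T • x) < δ₂ →
        bpow b.2 (ε T.length) • q = b.2 • q := by
      have h1 := hx.1
      cases h : ε T.length with
      | true => exact ⟨1, one_pos, fun _ _ => rfl⟩
      | false =>
        rw [h] at h1
        obtain ⟨r, hr, hball⟩ := Metric.isOpen_iff.1
          (show IsOpen (side G (supp X b.2) false) from isOpen_interior) _ h1
        exact ⟨r, hr, fun q hq => by
          rw [smul_eq_of_mem_side_false (hball hq)]; simp [bpow]⟩
    obtain ⟨η₁, hη₁, hu⟩ := exists_movesLess_eval_varWord (G := G) (X := X) b.1 (half_pos hδ)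
    obtain ⟨η₂, hη₂, hT⟩ := ih hx.2 (lt_min hδ₁ hδ₂)
    refine ⟨min η₁ η₂, lt_min hη₁ hη₂, fun g hg p hp => ?_⟩
    obtain ⟨e, d⟩ := hT g (hg.mono (min_le_right _ _)) p (hp.trans_le (min_le_right _ _))
    have d' := hu g (hg.mono (min_le_left _ _)) (b.2 • eval g (blockWord T) • p)
    have d'' := h₁ _ (d.trans_le (min_le_left _ _))
    rw [blockWord_cons, truncWord, blockConst_cons]
    simp only [eval_mul, eval_constWord, mul_smul]
    rw [e, h₂ _ (d.trans_le (min_le_right _ _))]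
    refine ⟨rfl, ?_⟩
    have := dist_triangle (eval g (varWord b.1) • b.2 • eval g (blockWord T) • p)
      (b.2 • eval g (blockWord T) • p) (b.2 • blockConst T • x)
    linarith

theorem Stage.exists_eval_smul_eq {w w' : GWord t G} {k : ℕ} {V : Set X} {L : Blocks t G}
    (h : Stage w k V w' L) {x : X} (hx : x ∈ V) :
    ∃ a : FreeGroup (Fin t), ∃ η > 0, ∀ g : Fin t → G, MovesLess X η g → ∀ p : X,
      dist p x < η →
        eval g w' • p = eval g (varWord a * w * (varWord a)⁻¹) • p := by
  induction h with
  | start h =>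
    obtain ⟨u, rfl⟩ := h.exists_conj
    exact ⟨u, 1, one_pos, fun _ _ _ _ => rfl⟩
  | @step k V w' w'' L L' ε h hL hne h' ih =>
    obtain ⟨a, η, hη, ha⟩ := ih hx.1
    obtain ⟨z, hz⟩ := h.exists_isStandardForm
    rw [hz.eq_blockWord hL] at ha
    obtain ⟨u, rfl⟩ := h'.exists_conj
    obtain ⟨η₁, hη₁, h₁⟩ := exists_eval_truncWord_smul (G := G) hx.2 one_pos
    have hm : 0 < min η η₁ := lt_min hη hη₁
    obtain ⟨η₂, hη₂, h₂⟩ :=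
      exists_movesLess_eval_varWord (G := G) (X := X) u⁻¹ (half_pos hm)
    -- One half of the radius is for the distance from `p` to `x`, the other for the displacement by
    -- the inverse of `u`.
    refine ⟨u * a, min (min η η₁ / 2) η₂, lt_min (half_pos hm) hη₂, fun g hg p hp => ?_⟩
    have d : dist ((eval g (varWord u))⁻¹ • p) x < min η η₁ := by
      have h3 := h₂ g (hg.mono (min_le_right _ _)) p
      rw [varWord_inv, eval_inv] at h3
      have h4 := dist_triangle ((eval g (varWord u))⁻¹ • p) p x
      have h5 := hp.trans_le (min_le_left _ _)
      linarith
    have hg' : MovesLess X (min η η₁) g :=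
      hg.mono ((min_le_left _ _).trans (half_le_self hm.le))
    have e := (h₁ g (hg'.mono (min_le_right _ _)) _ (d.trans_le (min_le_right _ _))).1
    have e' := ha g (hg'.mono (min_le_left _ _)) _ (d.trans_le (min_le_left _ _))
    simp only [eval_mul, eval_inv, varWord_mul, mul_smul, mul_inv_rev] at e e' ⊢
    rw [e, e']

end Displacement

/-! ### Right ends of reduced forms in the free product -/

section ReducedWords

open Monoid

universe u

/-- The two factors of the free product `F_t * G`, placed in a common universe. -/
def Factor (t : ℕ) (G : Type u) : Bool → Type u
  | true => G
  | false => ULift.{u} (FreeGroup (Fin t))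

variable {t : ℕ} {G : Type u} [Group G]

instance : ∀ b, Group (Factor t G b)
  | true => inferInstanceAs (Group G)
  | false => inferInstanceAs (Group (ULift.{u} (FreeGroup (Fin t))))

/-- A word in variables, as a letter. -/
def varLetter : FreeGroup (Fin t) →* Factor t G false :=
  (MulEquiv.ulift.{0, u}.symm : FreeGroup (Fin t) ≃* ULift.{u} (FreeGroup (Fin t))).toMonoidHom

/-- A constant, as a letter. -/
def constLetter : G →* Factor t G true := MonoidHom.id G

/-- The inclusion of the words in variables into the indexed free product. -/
def varFactor : FreeGroup (Fin t) →* CoprodI (Factor t G) := CoprodI.of.comp varLetter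

/-- The inclusion of the constants into the indexed free product. -/
def constFactor : G →* CoprodI (Factor t G) := CoprodI.of.comp constLetter

theorem varLetter_ne_one {a : FreeGroup (Fin t)} (ha : a ≠ 1) :
    (varLetter a : Factor t G false) ≠ 1 :=
  fun h => ha (congrArg ULift.down h)

theorem constLetter_ne_one {v : G} (hv : v ≠ 1) : (constLetter v : Factor t G true) ≠ 1 := hv

/-- The free product `F_t * G` as an indexed free product. -/
def toCoprodI : GWord t G →* CoprodI (Factor t G) := Coprod.lift varFactor constFactor

theorem toCoprodI_varWord (a : FreeGroup (Fin t)) :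
    toCoprodI (varWord a : GWord t G) = varFactor a := by
  simp [toCoprodI, varWord]

theorem toCoprodI_constWord (v : G) :
    toCoprodI (constWord v : GWord t G) = constFactor v := by
  simp [toCoprodI, constWord]

/-- The projection of each factor to the constants. -/
def factorConst : ∀ b, Factor t G b →* G
  | true => MonoidHom.id G
  | false => 1

theorem factorConst_varLetter (a : FreeGroup (Fin t)) :
    factorConst false (varLetter a : Factor t G false) = 1 := rfl

theorem factorConst_constLetter (v : G) :
    factorConst true (constLetter v : Factor t G true) = v := rfl

/-- The product of the constants in a list of letters. -/
def constProd (l : List (Σ b, Factor t G b)) : G := (l.map fun a => factorConst a.1 a.2).prod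

theorem constProd_cons (a : Σ b, Factor t G b) (l : List (Σ b, Factor t G b)) :
    constProd (a :: l) = factorConst a.1 a.2 * constProd l := by
  simp [constProd]

theorem lift_factorConst_prod (W : CoprodI.Word (Factor t G)) :
    CoprodI.lift factorConst W.prod = constProd W.toList := by
  simp [CoprodI.Word.prod, constProd, map_list_prod, Function.comp_def]

open Classical in
/-- The products of the constants in the right ends of the reduced form of `z`. -/
def suffixConsts (z : CoprodI (Factor t G)) : Set G :=
  {c | ∃ s, s <:+ (CoprodI.Word.equiv z).toList ∧ constProd s = c}

-- Left multiplication by one letter affects only the head of a reduced word, so every proper right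
-- end of the new form is already a right end of the old one.
open Classical in
theorem suffixConsts_of_mul {b : Bool} (m : Factor t G b) (z : CoprodI (Factor t G)) :
    suffixConsts (CoprodI.of m * z) ⊆
      insert (CoprodI.lift factorConst (CoprodI.of m * z)) (suffixConsts z) := by
  rintro c ⟨s, hs, rfl⟩
  by_cases hfull : s = (CoprodI.Word.equiv (CoprodI.of m * z)).toList
  · left
    rw [hfull, ← lift_factorConst_prod]
    congr 1
    exact (CoprodI.Word.equiv.symm_apply_apply (CoprodI.of m * z))
  · right
    have htail : ∀ p : CoprodI.Word.Pair (Factor t G) b, p.tail.toList <:+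
        (CoprodI.Word.rcons p).toList := by
      intro p
      unfold CoprodI.Word.rcons
      split_ifs
      · exact List.suffix_refl _
      · exact List.suffix_cons _ _
    have hproper : ∀ p : CoprodI.Word.Pair (Factor t G) b, s <:+ (CoprodI.Word.rcons p).toList →
        s ≠ (CoprodI.Word.rcons p).toList → s <:+ p.tail.toList := by
      intro p h1 h2
      unfold CoprodI.Word.rcons at h1 h2
      split_ifs at h1 h2
      · exact h1
      · exact (List.suffix_cons_iff.1 h1).resolve_left h2
    have e : CoprodI.Word.equiv (CoprodI.of m * z) =
        CoprodI.Word.rcons { CoprodI.Word.equivPair b (CoprodI.Word.equiv z) with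
          head := m * (CoprodI.Word.equivPair b (CoprodI.Word.equiv z)).head } := by
      rw [← CoprodI.Word.of_smul_def]
      exact mul_smul (CoprodI.of m) z (CoprodI.Word.empty : CoprodI.Word (Factor t G))
    rw [e] at hs hfull
    refine ⟨s, (hproper _ hs hfull).trans ?_, rfl⟩
    have := htail (CoprodI.Word.equivPair b (CoprodI.Word.equiv z))
    rwa [← CoprodI.Word.equivPair_symm, Equiv.symm_apply_apply] at this

theorem suffixConsts_one : suffixConsts (1 : CoprodI (Factor t G)) = {1} := by
  classical
  have : (CoprodI.Word.equiv (1 : CoprodI (Factor t G))).toList = [] := by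
    have : CoprodI.Word.equiv (1 : CoprodI (Factor t G)) = CoprodI.Word.empty :=
      one_smul (CoprodI (Factor t G)) (CoprodI.Word.empty : CoprodI.Word (Factor t G))
    rw [this]; rfl
  ext c
  simp [suffixConsts, this, constProd, eq_comm]

theorem mem_suffixConsts_prod {W : CoprodI.Word (Factor t G)} {s : List (Σ b, Factor t G b)}
    (hs : s <:+ W.toList) : constProd s ∈ suffixConsts W.prod := by
  classical
  refine ⟨s, ?_, rfl⟩
  rwa [show CoprodI.Word.equiv W.prod = W from CoprodI.Word.equiv.apply_symm_apply W]

theorem lift_factorConst_varFactor (a : FreeGroup (Fin t)) :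
    CoprodI.lift factorConst (varFactor a : CoprodI (Factor t G)) = 1 := by
  simp [varFactor, factorConst_varLetter]

theorem lift_factorConst_constFactor (v : G) :
    CoprodI.lift factorConst (constFactor v : CoprodI (Factor t G)) = v := by
  simp [constFactor, factorConst_constLetter]

theorem suffixConsts_varFactor_mul (a : FreeGroup (Fin t)) (z : CoprodI (Factor t G)) :
    suffixConsts (varFactor a * z) ⊆
      insert (CoprodI.lift factorConst z) (suffixConsts z) := by
  have := suffixConsts_of_mul (varLetter a) z
  rwa [show CoprodI.of (varLetter a) = varFactor a from rfl, map_mul,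
    lift_factorConst_varFactor, one_mul] at this

theorem suffixConsts_constFactor_mul (v : G) (z : CoprodI (Factor t G)) :
    suffixConsts (constFactor v * z) ⊆
      insert (v * CoprodI.lift factorConst z) (suffixConsts z) := by
  have := suffixConsts_of_mul (constLetter v) z
  rwa [show CoprodI.of (constLetter v) = constFactor v from rfl, map_mul,
    lift_factorConst_constFactor] at this

theorem lift_factorConst_truncWord (ε : ℕ → Bool) (L : Blocks t G) :
    CoprodI.lift factorConst (toCoprodI (truncWord ε L)) = truncConst ε L := by
  induction L with
  | nil => simp [truncWord, truncConst]
  | cons b T ih =>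
    simp only [truncWord, truncConst, map_mul, ih, toCoprodI_varWord, toCoprodI_constWord,
      lift_factorConst_varFactor, lift_factorConst_constFactor, one_mul]

/-- The word is built up from the right. Each letter contributes at most the constant product of the
whole word so far, to which variables contribute nothing; cancellation creates no new products. -/
theorem suffixConsts_truncWord_mul (ε : ℕ → Bool) (L : Blocks t G) (a : FreeGroup (Fin t)) :
    suffixConsts (toCoprodI (truncWord ε L) * varFactor a) ⊆
      {c | ∃ T, T <:+ L ∧ c = truncConst ε T} := by
  induction L with
  | nil =>
    intro c hc
    have := suffixConsts_varFactor_mul (G := G) a 1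
    rw [mul_one, suffixConsts_one, map_one] at this
    rw [truncWord, map_one, one_mul] at hc
    exact ⟨[], List.suffix_refl _, by simpa [truncConst] using this hc⟩
  | cons b T ih =>
    intro c hc
    simp only [truncWord, map_mul, toCoprodI_varWord, toCoprodI_constWord, mul_assoc] at hc
    have ht : CoprodI.lift factorConst (toCoprodI (truncWord ε T) * varFactor a) =
        truncConst ε T := by
      rw [map_mul, lift_factorConst_truncWord, lift_factorConst_varFactor, mul_one]
    have hfull : ∃ T', T' <:+ b :: T ∧
        bpow b.2 (ε T.length) * truncConst ε T = truncConst ε T' :=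
      ⟨b :: T, List.suffix_refl _, rfl⟩
    rcases suffixConsts_varFactor_mul _ _ hc with rfl | hc
    · rw [map_mul, ht, lift_factorConst_constFactor]
      exact hfull
    rcases suffixConsts_constFactor_mul _ _ hc with rfl | hc
    · rw [ht]
      exact hfull
    obtain ⟨T', hT', rfl⟩ := ih hc
    exact ⟨T', hT'.trans (List.suffix_cons _ _), rfl⟩

theorem suffixConsts_conj_truncWord (ε : ℕ → Bool) (L : Blocks t G) (a : FreeGroup (Fin t)) :
    suffixConsts (toCoprodI (varWord a * truncWord ε L * (varWord a)⁻¹)) ⊆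
      {c | ∃ T, T <:+ L ∧ c = truncConst ε T} := by
  intro c hc
  rw [mul_assoc, map_mul, map_mul, map_inv, toCoprodI_varWord, ← map_inv] at hc
  rcases suffixConsts_varFactor_mul _ _ hc with rfl | hc
  · rw [map_mul, lift_factorConst_truncWord, lift_factorConst_varFactor, mul_one]
    exact ⟨L, List.suffix_refl _, rfl⟩
  · exact suffixConsts_truncWord_mul ε L _ hc

/-- Adjoining a constant on the left of a reduced word that starts with variables. -/
theorem exists_word_constFactor_mul {T : Blocks t G} {W : CoprodI.Word (Factor t G)}
    (hW : W.prod = toCoprodI (blockWord T)) (hi : W.fstIdx ≠ some true)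
    (hs : ∀ T', T' <:+ T → ∃ s, s <:+ W.toList ∧ constProd s = blockConst T')
    {v : G} (hv : v ≠ 1) :
    ∃ W' : CoprodI.Word (Factor t G),
      W'.prod = constFactor v * toCoprodI (blockWord T) ∧ W'.fstIdx = some true ∧
      constProd W'.toList = v * blockConst T ∧
      ∀ T', T' <:+ T → ∃ s, s <:+ W'.toList ∧ constProd s = blockConst T' := by
  refine ⟨CoprodI.Word.cons (constLetter v) W hi (constLetter_ne_one hv), ?_, by simp, ?_, ?_⟩
  · rw [CoprodI.Word.prod_cons, hW]; rfl
  · rw [CoprodI.Word.cons_toList, constProd_cons, ← lift_factorConst_prod, hW, blockWord,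
      lift_factorConst_truncWord, factorConst_constLetter]
    rfl
  · intro T' hT'
    obtain ⟨s, h1, h2⟩ := hs T' hT'
    exact ⟨s, h1.trans (List.suffix_cons _ _), h2⟩

theorem exists_word_varFactor_mul {W : CoprodI.Word (Factor t G)}
    (hi : W.fstIdx = some true) {a : FreeGroup (Fin t)} (ha : a ≠ 1) :
    ∃ W' : CoprodI.Word (Factor t G), W'.prod = varFactor a * W.prod ∧
      W'.fstIdx = some false ∧ W.toList <:+ W'.toList := by
  refine ⟨CoprodI.Word.cons (varLetter a) W (by simp [hi]) (varLetter_ne_one ha),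
    ?_, by simp, List.suffix_cons _ _⟩
  rw [CoprodI.Word.prod_cons]; rfl

theorem exists_word_blockWord {L : Blocks t G} (hc : ∀ b ∈ L, b.2 ≠ 1) (hu : ∀ b ∈ L, b.1 ≠ 1) :
    ∃ W : CoprodI.Word (Factor t G), W.prod = toCoprodI (blockWord L) ∧
      W.fstIdx ≠ some true ∧
      ∀ T, T <:+ L → ∃ s, s <:+ W.toList ∧ constProd s = blockConst T := by
  induction L with
  | nil =>
    refine ⟨CoprodI.Word.empty, by simp [blockWord, truncWord], by simp [CoprodI.Word.fstIdx], ?_⟩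
    intro T hT
    rw [List.suffix_nil.1 hT]
    exact ⟨[], List.suffix_refl _, rfl⟩
  | cons b L ih =>
    obtain ⟨W, hW, hi, hs⟩ := ih (fun c h => hc c (List.mem_cons_of_mem _ h))
      (fun c h => hu c (List.mem_cons_of_mem _ h))
    obtain ⟨W₁, hW₁, hi₁, ht₁, hs₁⟩ :=
      exists_word_constFactor_mul hW hi hs (hc b List.mem_cons_self)
    obtain ⟨W₂, hW₂, hi₂, hs₂⟩ := exists_word_varFactor_mul hi₁ (hu b List.mem_cons_self)
    refine ⟨W₂, ?_, by simp [hi₂], ?_⟩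
    · rw [hW₂, hW₁, blockWord_cons, map_mul, map_mul, toCoprodI_varWord, toCoprodI_constWord,
        mul_assoc]
    · intro T hT
      rcases List.suffix_cons_iff.1 hT with rfl | hT
      · exact ⟨_, hs₂, ht₁⟩
      · obtain ⟨s, h1, h2⟩ := hs₁ T hT
        exact ⟨s, h1.trans hs₂, h2⟩

theorem IsReducedBlocks.blockConst_mem_suffixConsts {L T : Blocks t G} (hL : IsReducedBlocks L)
    (hT : T <:+ L) : blockConst T ∈ suffixConsts (toCoprodI (blockWord L)) := by
  obtain ⟨hne, hc, hu⟩ := hL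
  obtain _ | ⟨b, L⟩ := L
  · exact absurd rfl hne
  -- The leftmost block is treated apart, since its variable part may be trivial.
  obtain ⟨W, hW, hi, hs⟩ := exists_word_blockWord (fun c h => hc c (List.mem_cons_of_mem _ h)) hu
  obtain ⟨W₁, hW₁, hi₁, ht₁, hs₁⟩ :=
    exists_word_constFactor_mul hW hi hs (hc b List.mem_cons_self)
  obtain ⟨W₂, hW₂, hs₂⟩ : ∃ W₂ : CoprodI.Word (Factor t G),
      W₂.prod = toCoprodI (blockWord (b :: L)) ∧ W₁.toList <:+ W₂.toList := by
    rw [blockWord_cons, map_mul, map_mul, toCoprodI_varWord, toCoprodI_constWord, mul_assoc,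
      ← hW₁]
    by_cases hb : b.1 = 1
    · exact ⟨W₁, by simp [hb], List.suffix_refl _⟩
    · obtain ⟨W₂, h1, -, h2⟩ := exists_word_varFactor_mul hi₁ hb
      exact ⟨W₂, h1, h2⟩
  rw [← hW₂]
  rcases List.suffix_cons_iff.1 hT with rfl | hT
  · rw [blockConst_cons, ← ht₁]
    exact mem_suffixConsts_prod hs₂
  · obtain ⟨s, h1, h2⟩ := hs₁ T hT
    rw [← h2]
    exact mem_suffixConsts_prod (h1.trans hs₂)

/-- Every product of constants in the right ends of the standard form of a truncated word occurs
as a truncated product of constants. -/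
theorem IsStandardForm.exists_truncConst {ε : ℕ → Bool} {L L' T : Blocks t G} {w' : GWord t G}
    (h : IsStandardForm (truncWord ε L) w' L') (hT : T <:+ L') :
    ∃ T', T' <:+ L ∧ blockConst T = truncConst ε T' := by
  rcases h with ⟨rfl, -⟩ | ⟨hL', rfl, u, hu⟩
  · rw [List.suffix_nil.1 hT]
    exact ⟨[], List.nil_suffix, rfl⟩
  · have := hL'.blockConst_mem_suffixConsts hT
    rw [hu] at this
    exact suffixConsts_conj_truncWord ε L u this

/-- Going back one step yields a truncated product of the earlier constants, and on the region
truncation does not affect the image of `x`. -/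
theorem Stage.exists_blockConst_smul {X : Type*} [TopologicalSpace X] [MulAction G X]
    {w w' : GWord t G} {k : ℕ} {V : Set X} {L T : Blocks t G}
    (h : Stage w k V w' L) {x : X} (hx : x ∈ V) (hT : T <:+ L) :
    ∃ w₀ L₀ T₀, IsStandardForm w w₀ L₀ ∧ T₀ <:+ L₀ ∧ blockConst T • x = blockConst T₀ • x := by
  induction h generalizing T with
  | start h => exact ⟨_, _, T, h, hT, rfl⟩
  | step ε h hL hne h' ih =>
    obtain ⟨T', hT', e⟩ := h'.exists_truncConst hT
    rw [e, truncConst_smul (mem_signRegion_of_suffix hx.2 hT')]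
    exact ih hx.1 hT'

end ReducedWords

open scoped Topology

/-! ### Prescribed values at finitely many points -/

section Action

variable {t : ℕ} {G X : Type*} [Group G] [MulAction G X]

theorem smul_mem_of_fixes_compl {h : G} {Z : Set X} (hh : ∀ z ∉ Z, h • z = z) {z : X}
    (hz : z ∈ Z) : h • z ∈ Z := by
  by_contra hn
  exact hn (by rwa [smul_left_cancel h (hh _ hn)])

theorem smul_notMem_fixedPoints {x : X} (hx : x ∉ MulAction.fixedPoints G X) (v : G) :
    v • x ∉ MulAction.fixedPoints G X := by
  refine fun h => hx fun k => ?_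
  have h1 := h (v * k * v⁻¹)
  rw [mul_smul, mul_smul, inv_smul_smul] at h1
  exact smul_left_cancel v h1

theorem supp_mul_subset {W : Set X} {a b : G} (ha : supp X a ⊆ W) (hb : supp X b ⊆ W) :
    supp X (a * b) ⊆ W := by
  intro z hz
  by_contra hn
  have h1 : a • z = z := by_contra fun h => hn (ha h)
  have h2 : b • z = z := by_contra fun h => hn (hb h)
  exact hz (by rw [MulAction.mem_fixedBy, mul_smul, h2, h1])

theorem supp_inv (f : G) : supp X f⁻¹ = supp X f := by
  simp [supp, MulAction.fixedBy_inv]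

/-- The finite set `E` contains the chosen points `D i` of the domain of each `g i` together with
their images. -/
structure Frozen (g : Fin t → G) (D : Fin t → Set X) (E : Set X) : Prop where
  finite : E.Finite
  dom_mem : ∀ i, ∀ z ∈ D i, z ∈ E
  im_mem : ∀ i, ∀ z ∈ D i, g i • z ∈ E

/-- The tuples `g` and `g'` agree on the chosen points. -/
def Agree (D : Fin t → Set X) (g g' : Fin t → G) : Prop := ∀ i, ∀ z ∈ D i, g' i • z = g i • z

/-- The value of the letter `b` at `q` is not prescribed by the values of `g` at the chosen
points. -/
def Free (g : Fin t → G) (D : Fin t → Set X) (q : X) (b : Fin t × Bool) : Prop :=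
  ∀ z ∈ D b.1, if b.2 then z ≠ q else g b.1 • z ≠ q

/-- No constant in `C` takes `q` to another point of `E`. -/
def Fresh (C : Set G) (E : Set X) (q : X) : Prop := ∀ v ∈ C, v • q ∈ E → v • q = q

theorem Frozen.mono {g : Fin t → G} {D : Fin t → Set X} {E E' : Set X} (h : Frozen g D E)
    (hE : E ⊆ E') (hE' : E'.Finite) : Frozen g D E' :=
  ⟨hE', fun i z hz => hE (h.dom_mem i z hz), fun i z hz => hE (h.im_mem i z hz)⟩

theorem Frozen.free {g : Fin t → G} {D : Fin t → Set X} {E : Set X} (h : Frozen g D E) {q : X}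
    (hq : q ∉ E) (b : Fin t × Bool) : Free g D q b := by
  intro z hz
  split_ifs
  · rintro rfl
    exact hq (h.dom_mem _ _ hz)
  · rintro rfl
    exact hq (h.im_mem _ _ hz)

end Action

/-! ### Pushing a point off a finite set -/

section Push

variable {G X : Type*} [Group G] [MetricSpace X] [MulAction G X]

theorem dist_inv_smul_lt {f : G} {δ : ℝ} (hf : ∀ p : X, dist (f • p) p < δ) (p : X) :
    dist (f⁻¹ • p) p < δ := by
  have := hf (f⁻¹ • p)
  rwa [smul_inv_smul, dist_comm] at this

theorem dist_smul_lt_of_fixes_compl {h : G} {Z : Set X} (hh : ∀ z ∉ Z, h • z = z) {c : X} {r : ℝ}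
    (hr : 0 < r) (hZ : Z ⊆ Metric.ball c (r / 2)) (z : X) : dist (h • z) z < r := by
  by_cases hz : z ∈ Z
  · have h1 := Metric.mem_ball.1 (hZ hz)
    have h2 := Metric.mem_ball.1 (hZ (smul_mem_of_fixes_compl hh hz))
    have := dist_triangle_right (h • z) z c
    linarith
  · rw [hh z hz, dist_self]
    exact hr

variable [PerfectSpace X]

theorem infinite_of_isOpen {Z : Set X} (hZ : IsOpen Z) {x : X} (hx : x ∈ Z) : Z.Infinite :=
  haveI : (𝓝[≠] x).NeBot := inferInstance
  infinite_of_mem_nhds x (hZ.mem_nhds hx)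

/-- Under a hereditarily separating action, a point that is not fixed can be pushed off a given
finite set inside a given neighbourhood, while other finitely many points are kept in place. -/
theorem HereditarilySeparates.exists_push (hG : HereditarilySeparates G X) {Z Y A : Set X}
    (hZ : IsOpen Z) (hY : Y.Finite) (hA : A.Finite) {x : X} (hxZ : x ∈ Z)
    (hx : x ∉ MulAction.fixedPoints G X) (hxY : x ∉ Y) :
    ∃ h : G, (∀ z ∉ Z, h • z = z) ∧ (∀ z ∈ Y, h • z = z) ∧ h • x ∉ A := by
  by_contra! hcon
  let S : Set X := {y | ∃ h : G, (∀ z ∉ Z, h • z = z) ∧ (∀ z ∈ Y, h • z = z) ∧ h • x = y}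
  have hS : S.Finite := hA.subset (by rintro _ ⟨h, h1, h2, rfl⟩; exact hcon h h1 h2)
  have hSZ : S ⊆ Z := by
    rintro _ ⟨h, h1, -, rfl⟩
    by_contra hn
    exact hn (by rwa [smul_left_cancel h (h1 _ hn)])
  -- `S` is the orbit of `x` under the elements that fix `Y` and the complement of `Z`. Were it
  -- finite, some such `k` would move `x` and fix the rest of `S`; but then `k` fixes `k • x`, hence
  -- also `x`.
  obtain ⟨k, hk, hkx⟩ := hG.separates Z hZ (infinite_of_isOpen hZ hxZ) (Y ∩ Z ∪ S \ {x})
    ((hY.inter_of_left Z).union hS.sdiff)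
    (Set.union_subset Set.inter_subset_right (Set.sdiff_subset.trans hSZ)) x
    ⟨hxZ, by simp [hx, hxY]⟩
  rw [mem_fixingSubgroup_iff] at hk
  have hkZ : ∀ z ∉ Z, k • z = z := fun z hz => hk z (Or.inl hz)
  have hkS : k • x ∈ S := ⟨k, hkZ, fun z hz => by
    by_cases hzZ : z ∈ Z
    · exact hk z (Or.inr (Or.inl ⟨hz, hzZ⟩))
    · exact hkZ z hzZ, rfl⟩
  exact hkx (smul_left_cancel k (hk _ (Or.inr (Or.inr ⟨hkS, hkx⟩))))

end Push

/-! ### Choosing the value of one letter -/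

section Tracking

variable {t : ℕ} {G X : Type*} [Group G] [MetricSpace X] [PerfectSpace X] [MulAction G X]

/-- The value of one letter at one point is changed to a new point, near the old value. -/
theorem HereditarilySeparates.exists_letter_value (hG : HereditarilySeparates G X) {W : Set X}
    {D A : Set X} (hD : D.Finite) (hA : A.Finite) {f : G} {q y : X} {δ : ℝ} (hδ : 0 < δ)
    (hf : ∀ p : X, dist (f • p) p < δ)
    (hq : q ∉ MulAction.fixedPoints G X) (hqy : dist q y < δ) (hW : Metric.ball y (2 * δ) ⊆ W)
    (hqD : q ∉ D) :
    ∃ h : G, (∀ p : X, dist (h • p) p < δ) ∧ supp X h ⊆ W ∧ (∀ z ∈ D, h • f • z = f • z) ∧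
      h • f • q ∉ A ∧ dist (h • f • q) y < 2 * δ := by
  -- The first ball bounds the displacement of the push; the second keeps its support in `W` and the
  -- new value near `y`.
  have hz : f • q ∈ Metric.ball (f • q) (δ / 2) ∩ Metric.ball y (2 * δ) := by
    refine ⟨Metric.mem_ball_self (half_pos hδ), Metric.mem_ball.2 ?_⟩
    have := dist_triangle (f • q) q y
    have := hf q
    linarith
  obtain ⟨h, h1, h2, h3⟩ := hG.exists_push (Metric.isOpen_ball.inter Metric.isOpen_ball)
    (hD.image (f • ·)) hA hz (smul_notMem_fixedPoints hq f) (by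
      rintro ⟨z, hz, e⟩
      exact hqD (smul_left_cancel f e ▸ hz))
  refine ⟨h, dist_smul_lt_of_fixes_compl h1 hδ Set.inter_subset_left, ?_,
    fun z hz => h2 _ ⟨z, hz, rfl⟩, h3, (smul_mem_of_fixes_compl h1 hz).2⟩
  intro z hz
  by_contra hn
  exact hz (h1 z fun hz' => hn (hW hz'.2))

/-- Since the value of `a` at `q` is open, it can be pushed off `E` without disturbing prescribed
values. At the new point only the inverse of `a` has a prescribed value. Composing with the push
accounts for the doubled displacement. -/
theorem HereditarilySeparates.exists_letter_step (hG : HereditarilySeparates G X) {W : Set X}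
    {C : Set G} (hC : C.Finite) {g : Fin t → G} {D : Fin t → Set X} {E : Set X} {δ : ℝ}
    (hδ : 0 < δ) (hg : MovesLess X δ g) (hgW : ∀ i, supp X (g i) ⊆ W) (hE : Frozen g D E)
    {q y : X} (hqE : q ∈ E) (hq : q ∉ MulAction.fixedPoints G X) (hqy : dist q y < δ)
    (hW : Metric.ball y (2 * δ) ⊆ W) {a : Fin t × Bool} (ha : Free g D q a) :
    ∃ (g' : Fin t → G) (D' : Fin t → Set X) (E' : Set X) (q' : X),
      MovesLess X (2 * δ) g' ∧ (∀ i, supp X (g' i) ⊆ W) ∧ Frozen g' D' E' ∧ E ⊆ E' ∧ q' ∈ E' ∧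
      (∀ g'', Agree D' g' g'' → Agree D g g'' ∧ letterVal g'' a • q = q') ∧ q' ∉ E ∧
      Fresh C E' q' ∧ (∀ b : Fin t × Bool, (a.1 = b.1 → a.2 = b.2) → Free g' D' q' b) ∧
      dist q' y < 2 * δ := by
  classical
  obtain ⟨i, σ⟩ := a
  have hDf : (D i).Finite := hE.finite.subset (hE.dom_mem i)
  -- Avoiding the preimages of `E` under `C` is what makes the new point `Fresh`.
  have hA : (E ∪ ⋃ v ∈ C, (v • ·) ⁻¹' E).Finite := hE.finite.union (hC.biUnion fun v _ =>
    hE.finite.preimage (MulAction.injective v).injOn)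
  -- The new prescribed value is `k • s = r`; for an inverse letter, `q` is the image and the new
  -- point `q'` the argument.
  obtain ⟨k, s, r, q', hk, hkW, hkD, hsr, hc, hq'A, hq'y⟩ : ∃ (k : G) (s r q' : X),
      (∀ p : X, dist (k • p) p < 2 * δ) ∧ supp X k ⊆ W ∧ (∀ z ∈ D i, k • z = g i • z) ∧
      k • s = r ∧ ((σ = true ∧ s = q ∧ r = q') ∨ (σ = false ∧ s = q' ∧ r = q)) ∧
      q' ∉ (E ∪ ⋃ v ∈ C, (v • ·) ⁻¹' E) ∧ dist q' y < 2 * δ := by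
    cases σ with
    | true =>
      obtain ⟨h, h1, h2, h3, h4, h5⟩ := hG.exists_letter_value hDf hA hδ (hg i) hq hqy hW
        (fun h => by simpa using ha q h)
      refine ⟨h * g i, q, h • g i • q, h • g i • q, fun p => ?_, supp_mul_subset h2 (hgW i),
        fun z hz => by rw [mul_smul, h3 z hz], mul_smul _ _ _, Or.inl ⟨rfl, rfl, rfl⟩, h4, h5⟩
      rw [mul_smul]
      have := dist_triangle (h • g i • p) (g i • p) p
      have := h1 (g i • p)
      have := hg i p
      linarith
    | false =>
      -- Here the push is applied to `(g i)⁻¹`, whose prescribed arguments are the images of `D i`.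
      obtain ⟨h, h1, h2, h3, h4, h5⟩ := hG.exists_letter_value (hDf.image (g i • ·)) hA hδ
        (dist_inv_smul_lt (hg i)) hq hqy hW
        (fun ⟨z, hz, e⟩ => by simpa using ha z hz e)
      refine ⟨g i * h⁻¹, h • (g i)⁻¹ • q, q, h • (g i)⁻¹ • q, fun p => ?_,
        supp_mul_subset (hgW i) (by rwa [supp_inv]), fun z hz => ?_, ?_,
        Or.inr ⟨rfl, rfl, rfl⟩, h4, h5⟩
      · rw [mul_smul]
        have := dist_triangle (g i • h⁻¹ • p) (h⁻¹ • p) p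
        have := dist_inv_smul_lt h1 p
        have := hg i (h⁻¹ • p)
        linarith
      · have := h3 _ ⟨z, hz, rfl⟩
        simp only [inv_smul_smul] at this
        rw [mul_smul, inv_smul_eq_iff.2 this.symm]
      · rw [mul_smul, inv_smul_smul, smul_inv_smul]
  have hq'E : q' ∉ E := fun h => hq'A (Or.inl h)
  have hsE : s ∈ insert q' E ∧ r ∈ insert q' E := by
    rcases hc with ⟨-, rfl, rfl⟩ | ⟨-, rfl, rfl⟩
    · exact ⟨Or.inr hqE, Or.inl rfl⟩
    · exact ⟨Or.inl rfl, Or.inr hqE⟩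
  have hfro : Frozen (Function.update g i k) (Function.update D i (insert s (D i)))
      (insert q' E) := by
    refine ⟨hE.finite.insert q', fun j z hz => ?_, fun j z hz => ?_⟩
    · by_cases hj : j = i
      · subst hj
        rw [Function.update_self] at hz
        rcases hz with rfl | hz
        · exact hsE.1
        · exact Or.inr (hE.dom_mem _ _ hz)
      · rw [Function.update_of_ne hj] at hz
        exact Or.inr (hE.dom_mem _ _ hz)
    · by_cases hj : j = i
      · subst hj
        rw [Function.update_self] at hz ⊢
        rcases hz with rfl | hz
        · rw [hsr]
          exact hsE.2
        · rw [hkD z hz]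
          exact Or.inr (hE.im_mem _ _ hz)
      · rw [Function.update_of_ne hj] at hz ⊢
        exact Or.inr (hE.im_mem _ _ hz)
  refine ⟨Function.update g i k, Function.update D i (insert s (D i)), insert q' E, q',
    fun j p => ?_, fun j => ?_, hfro, Set.subset_insert _ _, Set.mem_insert _ _,
    fun g'' hg'' => ?_, hq'E, ?_, ?_, hq'y⟩
  · by_cases hj : j = i
    · subst hj
      rw [Function.update_self]
      exact hk p
    · rw [Function.update_of_ne hj]
      have := hg j p
      linarith
  · by_cases hj : j = i
    · subst hj
      rwa [Function.update_self]
    · rw [Function.update_of_ne hj]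
      exact hgW j
  · have hi : ∀ z ∈ insert s (D i), g'' i • z = k • z := by
      intro z hz
      have := hg'' i z (by rwa [Function.update_self])
      rwa [Function.update_self] at this
    refine ⟨fun j z hz => ?_, ?_⟩
    · by_cases hj : j = i
      · subst hj
        rw [hi z (Or.inr hz), hkD z hz]
      · have := hg'' j z (by rwa [Function.update_of_ne hj])
        rwa [Function.update_of_ne hj] at this
    · have h1 := hi s (Or.inl rfl)
      rw [hsr] at h1
      rcases hc with ⟨rfl, rfl, rfl⟩ | ⟨rfl, rfl, rfl⟩
      · simpa [letterVal] using h1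
      · simp [letterVal, ← h1]
  · rintro v hv (h | h)
    · exact h
    · exact absurd (Or.inr (Set.mem_biUnion hv h)) hq'A
  · rintro ⟨j, τ⟩ hb z hz
    by_cases hj : j = i
    · subst hj
      simp only [Function.update_self, true_implies] at hz hb ⊢
      subst hb
      rcases hz with rfl | hz
      · rcases hc with ⟨rfl, rfl, rfl⟩ | ⟨rfl, rfl, rfl⟩
        · simpa using fun h : z = r => hq'E (h ▸ hqE)
        · simpa [hsr] using fun h : r = z => hq'E (h ▸ hqE)
      · split_ifs
        · rintro rfl
          exact hq'E (hE.dom_mem _ _ hz)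
        · rw [hkD z hz]
          rintro rfl
          exact hq'E (hE.im_mem _ _ hz)
    · simp only [Function.update_of_ne hj] at hz ⊢
      exact hE.free hq'E (j, τ) z hz

end Tracking

/-! ### Following a point along a word -/

section Words

variable {t : ℕ} {G X : Type*} [Group G] [MetricSpace X] [MulAction G X]

/-- The word `w` takes `p`, a point near `x`, to `q`, a point near `y`, whenever `y₁, …, y_t` take
the values of the tuple `g` at the chosen points; this tuple is supported in `W`, moves points
by less than `δ`, and the property `Φ δ` is determined by its values at the chosen points. -/
structure Track (W : Set X) (Φ : ℝ → (Fin t → G) → Prop) (w : GWord t G) (x y : X) (δ : ℝ)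
    (g : Fin t → G) (D : Fin t → Set X) (E : Set X) (p q : X) : Prop where
  moves : MovesLess X δ g
  supp_subset : ∀ i, supp X (g i) ⊆ W
  frozen : Frozen g D E
  start_mem : p ∈ E
  end_mem : q ∈ E
  not_fixed : q ∉ MulAction.fixedPoints G X
  dist_start : dist p x < δ
  dist_end : dist q y < δ
  determined : ∀ g', Agree D g g' → Φ δ g' ∧ eval g' w • p = q

/-- There are tuples as in `Track`, with arbitrarily small displacement, that have the
additional property `P`. -/
def Tracked (W : Set X) (Φ : ℝ → (Fin t → G) → Prop) (w : GWord t G) (x y : X)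
    (P : (Fin t → G) → (Fin t → Set X) → Set X → X → X → Prop) : Prop :=
  ∀ δ > 0, ∃ g D E p q, Track W Φ w x y δ g D E p q ∧ P g D E p q

theorem Tracked.mono {W : Set X} {Φ : ℝ → (Fin t → G) → Prop} {w : GWord t G} {x y : X}
    {P Q : (Fin t → G) → (Fin t → Set X) → Set X → X → X → Prop} (h : Tracked W Φ w x y P)
    (hPQ : ∀ g D E p q, P g D E p q → Q g D E p q) : Tracked W Φ w x y Q := by
  intro δ hδ
  obtain ⟨g, D, E, p, q, h1, h2⟩ := h δ hδ
  exact ⟨g, D, E, p, q, h1, hPQ _ _ _ _ _ h2⟩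

/-- The property `Φ δ` can be guaranteed by the values at finitely many points of a tuple that is
supported in `W` and moves points by less than `δ`. -/
def Forceable (X : Type*) [MetricSpace X] [MulAction G X] (W : Set X)
    (Φ : ℝ → (Fin t → G) → Prop) : Prop :=
  ∀ δ > 0, ∃ (g : Fin t → G) (D : Fin t → Set X) (E : Set X), MovesLess X δ g ∧
    (∀ i, supp X (g i) ⊆ W) ∧ Frozen g D E ∧ ∀ g', Agree D g g' → Φ δ g'

variable {W : Set X} {Φ : ℝ → (Fin t → G) → Prop} {C : Set G}

/-- Near `y` the constant moves every point, so freshness sends `q` out of `E`. Outside `E` no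
letter has a prescribed value, and the start `p` lies in `E`. -/
theorem Tracked.const_mul [ContinuousConstSMul G X]
    (hmono : ∀ δ δ' g, δ ≤ δ' → Φ δ g → Φ δ' g) {w : GWord t G} {x y : X}
    (h : Tracked W Φ w x y (fun _ _ E _ q => Fresh C E q)) {v : G} (hv : v ∈ C)
    (hy : y ∈ supp X v) :
    Tracked W Φ (constWord v * w) x (v • y)
      (fun g D _ p q => q ≠ p ∧ ∀ b, Free g D q b) := by
  intro δ hδ
  obtain ⟨η, hη, h₁⟩ := exists_dist_smul_lt v y hδ
  obtain ⟨r, hr, h₂⟩ := Metric.isOpen_iff.1 (isOpen_supp v) y hy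
  obtain ⟨g, D, E, p, q, T, hfr⟩ := h (min δ (min η r)) (lt_min hδ (lt_min hη hr))
  have hq : q ∈ supp X v :=
    h₂ (T.dist_end.trans_le ((min_le_right _ _).trans (min_le_right _ _)))
  have hvE : v • q ∉ E := fun h => hq (hfr v hv h)
  refine ⟨g, D, insert (v • q) E, p, v • q, ⟨T.moves.mono (min_le_left _ _), T.supp_subset,
    T.frozen.mono (Set.subset_insert _ _) (T.frozen.finite.insert _), Or.inr T.start_mem,
    Or.inl rfl, smul_notMem_fixedPoints T.not_fixed v, T.dist_start.trans_le (min_le_left _ _),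
    h₁ q (T.dist_end.trans_le ((min_le_right _ _).trans (min_le_left _ _))),
    fun g' hg' => ?_⟩, fun h => hvE (h ▸ T.start_mem), T.frozen.free hvE⟩
  obtain ⟨h3, h4⟩ := T.determined g' hg'
  exact ⟨hmono _ _ _ (min_le_left _ _) h3, by rw [eval_mul, mul_smul, h4, eval_constWord]⟩

variable [PerfectSpace X]

theorem Forceable.tracked_one (hΦ : Forceable X W Φ) (hC : C.Finite)
    (hF : (MulAction.fixedPoints G X).Finite) {x : X} (hx : x ∉ MulAction.fixedPoints G X) :
    Tracked W Φ 1 x x (fun g D E _ q => Fresh C E q ∧ ∀ b, Free g D q b) := by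
  intro δ hδ
  obtain ⟨g, D, E, h1, h2, h3, h4⟩ := hΦ δ hδ
  have hA : (E ∪ ⋃ v ∈ C, (v • ·) ⁻¹' E).Finite := h3.finite.union (hC.biUnion fun v _ =>
    h3.finite.preimage (MulAction.injective v).injOn)
  obtain ⟨p, ⟨hp, hpF⟩, hpA⟩ := ((infinite_of_isOpen (Metric.isOpen_ball.sdiff hF.isClosed)
    ⟨Metric.mem_ball_self hδ, hx⟩).sdiff hA).nonempty
  have hpE : p ∉ E := fun h => hpA (Or.inl h)
  refine ⟨g, D, insert p E, p, p, ⟨h1, h2, h3.mono (Set.subset_insert _ _) (h3.finite.insert p),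
    Or.inl rfl, Or.inl rfl, hpF, hp, hp, fun g' hg' => ⟨h4 g' hg', by rw [eval_one, one_smul]⟩⟩,
    ?_, fun b => h3.free hpE b⟩
  rintro v hv (h | h)
  · exact h
  · exact absurd (Or.inr (Set.mem_biUnion hv h)) hpA

theorem Tracked.letter_mul (hG : HereditarilySeparates G X) (hC : C.Finite)
    (hmono : ∀ δ δ' g, δ ≤ δ' → Φ δ g → Φ δ' g) (hW : IsOpen W)
    {w : GWord t G} {x y : X} (hy : y ∈ W) {a : Fin t × Bool} {l : List (Fin t × Bool)}
    (h : Tracked W Φ (varWord (.mk l) * w) x y (fun g D _ _ q => Free g D q a)) :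
    Tracked W Φ (varWord (.mk (a :: l)) * w) x y (fun g D E p q => q ≠ p ∧ Fresh C E q ∧
      ∀ b : Fin t × Bool, (a.1 = b.1 → a.2 = b.2) → Free g D q b) := by
  intro δ hδ
  obtain ⟨r, hr, hball⟩ := Metric.isOpen_iff.1 hW y hy
  -- Adding a letter doubles the displacement, and the doubled ball around `y` must stay in `W`.
  set η := min δ r / 2
  have hη : 0 < η := half_pos (lt_min hδ hr)
  have h2η : 2 * η = min δ r := mul_div_cancel₀ _ two_ne_zero
  have hle : 2 * η ≤ δ := h2η ▸ min_le_left _ _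
  obtain ⟨g, D, E, p, q, T, hfree⟩ := h η hη
  obtain ⟨g', D', E', q', h1, h2, h3, h4, h5, h6, h7, h8, h9, h10⟩ :=
    hG.exists_letter_step hC hη T.moves T.supp_subset T.frozen T.end_mem T.not_fixed T.dist_end
      ((Metric.ball_subset_ball (h2η ▸ min_le_right _ _)).trans hball) hfree
  have hdet : ∀ g'', Agree D' g' g'' →
      Φ η g'' ∧ eval g'' (varWord (.mk (a :: l)) * w) • p = q' := by
    intro g'' hg''
    obtain ⟨e1, e2⟩ := h6 g'' hg''
    obtain ⟨e3, e4⟩ := T.determined g'' e1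
    rw [eval_mul] at e4
    exact ⟨e3, by rw [eval_mul, eval_varWord_mk_cons, mul_assoc, mul_smul, e4, e2]⟩
  refine ⟨g', D', E', p, q', ⟨h1.mono hle, h2, h3, h4 T.start_mem, h5, ?_,
    T.dist_start.trans_le (by linarith), h10.trans_le hle, fun g'' hg'' => ?_⟩,
    fun h => h7 (h ▸ T.start_mem), h8, h9⟩
  · rw [← (h6 g' fun _ _ _ => rfl).2]
    exact smul_notMem_fixedPoints T.not_fixed _
  · exact ⟨hmono _ _ _ (by linarith) (hdet g'' hg'').1, (hdet g'' hg'').2⟩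

theorem Tracked.var_mul (hG : HereditarilySeparates G X) (hC : C.Finite)
    (hmono : ∀ δ δ' g, δ ≤ δ' → Φ δ g → Φ δ' g) (hW : IsOpen W)
    {w : GWord t G} {x y : X} (hy : y ∈ W)
    (h : Tracked W Φ w x y (fun g D _ _ q => ∀ b, Free g D q b))
    {u : FreeGroup (Fin t)} (hu : u ≠ 1) :
    Tracked W Φ (varWord u * w) x y (fun _ _ E p q => q ≠ p ∧ Fresh C E q) := by
  have key : ∀ (l : List (Fin t × Bool)) (a : Fin t × Bool), FreeGroup.IsReduced (a :: l) →
      Tracked W Φ (varWord (.mk (a :: l)) * w) x y (fun g D E p q => q ≠ p ∧ Fresh C E q ∧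
        ∀ b : Fin t × Bool, (a.1 = b.1 → a.2 = b.2) → Free g D q b) := by
    intro l
    induction l with
    | nil =>
      intro a _
      refine Tracked.letter_mul hG hC hmono hW hy ?_
      rw [← FreeGroup.one_eq_mk, varWord_one, one_mul]
      exact h.mono fun _ _ _ _ _ hb => hb a
    | cons c l ih =>
      intro a hr
      rw [FreeGroup.isReduced_cons_cons] at hr
      refine Tracked.letter_mul hG hC hmono hW hy ((ih c hr.2).mono ?_)
      -- Reducedness: the next letter is not the inverse of the one just applied, so its value is
      -- open.
      exact fun _ _ _ _ _ hb => hb.2.2 a fun e => (hr.1 e.symm).symm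
  have hmk : u = .mk u.toWord := FreeGroup.mk_toWord.symm
  have hred := FreeGroup.isReduced_toWord (x := u)
  cases hl : u.toWord with
  | nil => exact absurd (FreeGroup.toWord_eq_nil_iff.1 hl) hu
  | cons a l =>
    rw [hl] at hred hmk
    rw [hmk]
    exact (key l a hred).mono fun _ _ _ _ _ hb => ⟨hb.1, hb.2.1⟩

theorem Forceable.tracked_blockWord [ContinuousConstSMul G X] (hG : HereditarilySeparates G X)
    (hmono : ∀ δ δ' g, δ ≤ δ' → Φ δ g → Φ δ' g) (hW : IsOpen W) (hΦ : Forceable X W Φ)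
    (hC : C.Finite) {T : Blocks t G} (hTC : ∀ b ∈ T, b.2 ∈ C) (hTu : ∀ b ∈ T, b.1 ≠ 1) {x : X}
    (hx : x ∈ constRegion X T) (hxF : x ∉ MulAction.fixedPoints G X)
    (hTW : ∀ T', T' <:+ T → blockConst T' • x ∈ W) :
    Tracked W Φ (blockWord T) x (blockConst T • x) (fun _ _ E _ q => Fresh C E q) := by
  induction T with
  | nil =>
    have := (hΦ.tracked_one hC hG.finite_fixedPoints hxF).mono fun _ _ _ _ _ h => h.1
    simpa [blockWord, blockConst, truncWord, truncConst] using this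
  | cons b T ih =>
    have h1 := ih (fun c h => hTC c (List.mem_cons_of_mem _ h))
      (fun c h => hTu c (List.mem_cons_of_mem _ h)) hx.2
      (fun T' h => hTW T' (h.trans (List.suffix_cons _ _)))
    have h2 := h1.const_mul hmono (hTC b List.mem_cons_self) hx.1
    have h3 := (h2.mono fun _ _ _ _ _ h => h.2).var_mul hG hC hmono hW
      (by simpa [blockConst_cons, mul_smul] using hTW _ (List.suffix_refl _))
      (hTu b List.mem_cons_self)
    rw [blockWord_cons, blockConst_cons, mul_smul, mul_assoc]
    exact h3.mono fun _ _ _ _ _ h => h.2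

/-- A nontrivial word in standard form moves some point near each point of the region where it
oscillates. -/
theorem Forceable.tracked_ne [ContinuousConstSMul G X] (hG : HereditarilySeparates G X)
    (hmono : ∀ δ δ' g, δ ≤ δ' → Φ δ g → Φ δ' g) (hW : IsOpen W) (hΦ : Forceable X W Φ)
    {z w : GWord t G} {L : Blocks t G} (hw : IsStandardForm z w L) (hw1 : w ≠ 1) {x : X}
    (hx : x ∈ oscRegion X L) (hLW : ∀ T, T <:+ L → blockConst T • x ∈ W) :
    ∃ y, Tracked W Φ w x y (fun _ _ _ p q => q ≠ p) := by
  rcases hw with ⟨rfl, rfl, u, rfl⟩ | ⟨hL, rfl, -⟩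
  · have h1 := (hΦ.tracked_one Set.finite_empty hG.finite_fixedPoints hx.2).mono
      fun _ _ _ _ _ h => h.2
    have h2 := h1.var_mul hG Set.finite_empty hmono hW (u := u)
      (by simpa [blockConst, truncConst] using hLW [] (List.suffix_refl _))
      (by rintro rfl; exact hw1 varWord_one)
    rw [mul_one] at h2
    exact ⟨x, h2.mono fun _ _ _ _ _ h => h.1⟩
  · obtain _ | ⟨b, T⟩ := L
    · exact absurd rfl hL.ne_nil
    have hC : {v | ∃ c ∈ b :: T, c.2 = v}.Finite := by
      refine ((b :: T).map Prod.snd).finite_toSet.subset ?_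
      rintro v ⟨c, hc, rfl⟩
      exact List.mem_map_of_mem hc
    have h1 := hΦ.tracked_blockWord hG hmono hW hC
      (fun c h => ⟨c, List.mem_cons_of_mem _ h, rfl⟩) hL.var_ne_one hx.1.2 hx.2
      (fun T' h => hLW T' (h.trans (List.suffix_cons _ _)))
    have h2 := h1.const_mul hmono ⟨b, List.mem_cons_self, rfl⟩ hx.1.1
    refine ⟨b.2 • blockConst T • x, ?_⟩
    rw [blockWord_cons, mul_assoc]
    -- If the leftmost variable part is trivial, the last constant already separates the end from
    -- the start.
    by_cases hb : b.1 = 1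
    · rw [hb, varWord_one, one_mul]
      exact h2.mono fun _ _ _ _ _ h => h.1
    · exact ((h2.mono fun _ _ _ _ _ h => h.2).var_mul hG hC hmono hW
        (by simpa [blockConst_cons, mul_smul] using hLW _ (List.suffix_refl _)) hb).mono
          fun _ _ _ _ _ h => h.1

/-- The tracking of each further word keeps the values that already force the earlier words to act
nontrivially. -/
theorem forceable_forall [ContinuousConstSMul G X] (hG : HereditarilySeparates G X)
    (hW : IsOpen W) {m : ℕ} {z w : Fin m → GWord t G} {L : Fin m → Blocks t G}
    (hw : ∀ j, IsStandardForm (z j) (w j) (L j)) (hw1 : ∀ j, w j ≠ 1) {x : Fin m → X}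
    (hx : ∀ j, x j ∈ oscRegion X (L j))
    (hLW : ∀ j T, T <:+ L j → blockConst T • x j ∈ W) (n : ℕ) :
    Forceable X W fun δ (g : Fin t → G) =>
      ∀ j : Fin m, j.1 < n → ∃ p, dist p (x j) < δ ∧ eval g (w j) • p ≠ p := by
  induction n with
  | zero =>
    intro δ hδ
    refine ⟨fun _ => 1, fun _ => ∅, ∅, fun _ p => by simpa using hδ, fun _ => ?_, ⟨?_, ?_, ?_⟩, ?_⟩
    · simp [supp]
    all_goals simp
  | succ n ih =>
    by_cases hn : n < m
    · obtain ⟨y, h⟩ := ih.tracked_ne hG (fun δ δ' g hδ h j hj => by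
        obtain ⟨p, h1, h2⟩ := h j hj
        exact ⟨p, h1.trans_le hδ, h2⟩) hW (hw ⟨n, hn⟩) (hw1 ⟨n, hn⟩) (hx ⟨n, hn⟩) (hLW ⟨n, hn⟩)
      intro δ hδ
      obtain ⟨g, D, E, p, q, T, hne⟩ := h δ hδ
      refine ⟨g, D, E, T.moves, T.supp_subset, T.frozen, fun g' hg' j hj => ?_⟩
      obtain ⟨h1, h2⟩ := T.determined g' hg'
      rcases Nat.lt_succ_iff_lt_or_eq.1 hj with hj | hj
      · exact h1 j hj
      · obtain rfl : j = ⟨n, hn⟩ := Fin.ext hj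
        exact ⟨p, T.dist_start, by rwa [h2]⟩
    · intro δ hδ
      obtain ⟨g, D, E, h1, h2, h3, h4⟩ := ih δ hδ
      exact ⟨g, D, E, h1, h2, h3, fun g' hg' j _ => h4 g' hg' j (by omega)⟩

end Words

theorem isOpen_translate {t : ℕ} {G X : Type*} [Group G] [TopologicalSpace X] [MulAction G X]
    [ContinuousConstSMul G X] {w : GWord t G} {A B : Set X} (hA : IsOpen A)
    (hB : B ∈ translates w A) : IsOpen B := by
  obtain ⟨_, _, _, _, _, _, rfl⟩ := hB
  exact isOpenMap_smul _ A hA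

theorem exists_eval_ne_one {G X : Type*} [Group G] [MetricSpace X] [PerfectSpace X]
    [MulAction G X] [ContinuousConstSMul G X] (hG : HereditarilySeparates G X)
    {t m : ℕ} (w : Fin m → GWord t G) (O : Fin m → Set X)
    (hO : ∀ j, IsOpen (O j) ∧ (O j).Nonempty ∧ O j ⊆ oscHat X (w j)) :
    ∃ g : Fin t → G, (∀ j, eval g (w j) ≠ 1) ∧
      ∀ i, supp X (g i) ⊆ ⋃ j, ⋃₀ translates (w j) (O j) := by
  have hW : IsOpen (⋃ j, ⋃₀ translates (w j) (O j)) :=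
    isOpen_iUnion fun j => isOpen_sUnion fun _ hB => isOpen_translate (hO j).1 hB
  choose x hx using fun j => (hO j).2.1
  choose k V w' L hk hs he hxV using fun j => (hO j).2.2 (hx j)
  choose z hz using fun j => (hs j).exists_isStandardForm
  choose a η hη ha using fun j => (hs j).exists_eval_smul_eq (hxV j).1
  obtain ⟨δ, hδ, hδη⟩ : ∃ δ > 0, ∀ j, δ ≤ η j := by
    have hev : ∀ᶠ δ in 𝓝[>] (0 : ℝ), ∀ j, δ ≤ η j := Filter.eventually_all.2 fun j =>
      mem_nhdsWithin_of_mem_nhds (Iic_mem_nhds (hη j))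
    obtain ⟨δ, h1, h2⟩ := (hev.and self_mem_nhdsWithin).exists
    exact ⟨δ, h2, h1⟩
  obtain ⟨g, D, E, h1, h2, -, h3⟩ := forceable_forall hG hW hz (fun j => (he j).1)
    (fun j => (hxV j).2) (fun j T hT => by
      obtain ⟨w₀, L₀, T₀, e1, e2, e3⟩ := (hs j).exists_blockConst_smul (hxV j).1 hT
      rw [e3]
      -- The full product of constants is the truncated one with all exponents `1`, so the point
      -- lies in a translate of `O j`.
      exact Set.mem_iUnion.2 ⟨j, _, ⟨w₀, L₀, T₀, fun _ => true, e1, e2, rfl⟩, x j, hx j, rfl⟩)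
    m δ hδ
  refine ⟨g, fun j hj => ?_, h2⟩
  obtain ⟨p, hp, hne⟩ := h3 g (fun _ _ _ => rfl) j j.2
  rw [ha j g (h1.mono (hδη j)) p (hp.trans_le (hδη j))] at hne
  -- If `w j` had value `1`, so would its conjugate, which moves `p`.
  simp [eval_mul, eval_inv, hj] at hne

end MixedWords

theorem theorem2p7 {G X : Type*} [Group G] [MetricSpace X] [PerfectSpace X]
    [MulAction G X] [ContinuousConstSMul G X]
    (hG : MixedWords.HereditarilySeparates G X)
    {t m : ℕ} (w : Fin m → MixedWords.GWord t G)
    (hnonconst : ∀ j, ∀ v : G, w j ≠ MixedWords.constWord v)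
    (hosc : ∀ j, MixedWords.Oscillating X (w j)) :
    (∃ g : Fin t → G, ∀ j, MixedWords.eval g (w j) ≠ 1) ∧
    ∀ O : Fin m → Set X,
      (∀ j, IsOpen (O j) ∧ (O j).Nonempty ∧ O j ⊆ MixedWords.oscHat X (w j)) →
      ∃ g : Fin t → G, (∀ j, MixedWords.eval g (w j) ≠ 1) ∧
        ∀ i, MixedWords.supp X (g i) ⊆ ⋃ j, ⋃₀ MixedWords.translates (w j) (O j) := by
  refine ⟨?_, MixedWords.exists_eval_ne_one hG w⟩
  obtain ⟨g, hg, -⟩ := MixedWords.exists_eval_ne_one hG w (fun j => MixedWords.oscHat X (w j))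
    fun j => ⟨MixedWords.isOpen_oscHat hG.finite_fixedPoints _, (hosc j).oscHat_nonempty,
      subset_rfl⟩
  exact ⟨g, hg⟩
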